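/- Let $n\ge 1$. For $h=1/N$ with $N$ a positive integer, and $E\subset\mathbb R^n$, write $E^h=E\cap(h\mathbb Z)^n$. Call $u:E^h\to\mathbb R$ $h$-harmonic on $E^h$ if $$2n\,u(x)=\sum_{j=1}^n\bigl(u(x+he_j)+u(x-he_j)\bigr)$$ for every $x\in E^h$ all of whose $2n$ neighbours $x\pm he_j$ belong to $E^h$, where $e_1,\dots,e_n$ is the standard basis of $\mathbb R^n$. Write $\max_{E^h}|u|$ for $\sup_{x\in E^h}|u(x)|$ (understood as $0$ if $E^h=\emptyset$). Let $\Omega\subset\mathbb R^n$ be a domain (a nonempty connected open set), $O\subset\Omega$ a nonempty open set and $K\subset\Omega$ a compact set. Then there exist constants $C>0$, $\alpha\in(0,1)$, $\delta\in(0,1)$ and $N_0\in\mathbb N$, depending only on $n,\Omega,O,K$, such that for every integer $N>N_0$, with $h=1/N$, and every $h$-harmonic function $u$ on $\Omega^h$ that is bounded on $\Omega^h$ (which is automatic when $\Omega$ is bounded), $$\max_{K^h}|u|\le C\left(\left(\frac{\max_{O^h}|u|}{\max_{\Omega^h}|u|}\right)^{\alpha}+\delta^{\sqrt N}\right)\max_{\Omega^h}|u|,$$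 where the quotient is read as $0$ if $u\equiv0$ on $\Omega^h$. -/

import Mathlib

/-- The lattice `(hℤ)ⁿ` in `ℝⁿ` (`ℝⁿ` is `Fin n → ℝ`; only its topology is used). -/
def hLattice (n : ℕ) (h : ℝ) : Set (Fin n → ℝ) :=
  {x | ∀ j, ∃ k : ℤ, x j = h * k}

/-- The discretization `E^h = E ∩ (hℤ)ⁿ` of a set `E ⊆ ℝⁿ`. -/
def discretize {n : ℕ} (h : ℝ) (E : Set (Fin n → ℝ)) : Set (Fin n → ℝ) :=
  E ∩ hLattice n h

/-- `u` is `h`-discrete harmonic at `x`: `2n u(x) = ∑ⱼ (u(x + h eⱼ) + u(x - h eⱼ))`. -/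
def IsDiscreteHarmonicAt {n : ℕ} (h : ℝ) (u : (Fin n → ℝ) → ℝ) (x : Fin n → ℝ) : Prop :=
  2 * (n : ℝ) * u x =
    ∑ j : Fin n, (u (x + h • Pi.single j (1 : ℝ)) + u (x - h • Pi.single j (1 : ℝ)))

/-- `u` is `h`-discrete harmonic on `E^h`: the mean value equation holds at every point of `E^h`
all of whose `2n` lattice neighbours lie in `E^h`. Thus only the values of `u` on `E^h` matter,
and `u` stands for a function on `E^h`. -/
def IsDiscreteHarmonicOn {n : ℕ} (h : ℝ) (u : (Fin n → ℝ) → ℝ) (E : Set (Fin n → ℝ)) : Prop :=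
  ∀ x ∈ discretize h E,
    (∀ j : Fin n, x + h • Pi.single j (1 : ℝ) ∈ discretize h E ∧
      x - h • Pi.single j (1 : ℝ) ∈ discretize h E) →
    IsDiscreteHarmonicAt h u x

/-- The values `|u(x)|`, `x ∈ E^h`. -/
def absValues {n : ℕ} (h : ℝ) (u : (Fin n → ℝ) → ℝ) (E : Set (Fin n → ℝ)) : Set ℝ :=
  (fun x => |u x|) '' discretize h E

/-- `max_{E^h} |u|`: the supremum of `|u|` on `E^h`, which is the maximum when `E^h` is finite
and nonempty, and `0` when `E^h` is empty. -/
noncomputable def latticeMax {n : ℕ} (h : ℝ) (u : (Fin n → ℝ) → ℝ) (E : Set (Fin n → ℝ)) : ℝ :=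
  sSup (absValues h u E)

/-! Discrete harmonic functions behave like analytic functions down to the lattice scale. A
symmetric difference of step `2s` is at most `2n|s|/L` times the sup over a cube of radius `L`; with
`L = 16ns`, a `d`-fold difference is at most `8^{-d} M`. So on a line the function is nearly a
polynomial of degree `< d`, and it can be extrapolated from a segment of half-length `m` to
half-length `3m/2` (`abs_le_pow_of_small_on_segment`). If it is at most `tM` on the segment, the
result is `9^d tM + 2^{-d} M` for every `d ≤ m/2`, the cap on `d` coming from the lattice spacing.
The best `d` gives `3 (t^{1/12} + e^{-m/12}) M`.

Doing this one coordinate at a time enlarges a cube by the factor `3/2`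
(`exists_abs_le_of_small_on_cube`). In the sup norm balls are cubes, so smallness spreads from a
ball to a concentric one whose radius depends only on the room in `Ω`. Connectedness of `Ω` and
compactness of `K` finish the proof. The error obtained is `exp (-c N)`, stronger than the required
`δ ^ √N`. -/

/-! ### The discrete Laplacian and its symmetries. -/

/-- The unnormalised discrete Laplacian on `ℤⁿ`. -/
noncomputable def latticeLaplacian {n : ℕ} (f : (Fin n → ℤ) → ℝ) (x : Fin n → ℤ) : ℝ :=
  ∑ i, (f (x + Pi.single i 1) + f (x - Pi.single i 1) - 2 * f x)

lemma latticeLaplacian_sub {n : ℕ} (f g : (Fin n → ℤ) → ℝ) (x : Fin n → ℤ) :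
    latticeLaplacian (fun y => f y - g y) x = latticeLaplacian f x - latticeLaplacian g x := by
  simp only [latticeLaplacian, ← Finset.sum_sub_distrib]
  exact Finset.sum_congr rfl fun i _ => by ring

lemma latticeLaplacian_add {n : ℕ} (f g : (Fin n → ℤ) → ℝ) (x : Fin n → ℤ) :
    latticeLaplacian (fun y => f y + g y) x = latticeLaplacian f x + latticeLaplacian g x := by
  simp only [latticeLaplacian, ← Finset.sum_add_distrib]
  exact Finset.sum_congr rfl fun i _ => by ring

lemma latticeLaplacian_const_mul {n : ℕ} (a : ℝ) (f : (Fin n → ℤ) → ℝ) (x : Fin n → ℤ) :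
    latticeLaplacian (fun y => a * f y) x = a * latticeLaplacian f x := by
  simp only [latticeLaplacian, Finset.mul_sum]
  exact Finset.sum_congr rfl fun i _ => by ring

lemma latticeLaplacian_sum {n : ℕ} {ι : Type*} (s : Finset ι) (f : ι → (Fin n → ℤ) → ℝ)
    (x : Fin n → ℤ) :
    latticeLaplacian (fun y => ∑ k ∈ s, f k y) x = ∑ k ∈ s, latticeLaplacian (f k) x := by
  simp only [latticeLaplacian]
  rw [Finset.sum_comm]
  refine Finset.sum_congr rfl fun i _ => ?_
  simp only [Finset.mul_sum, Finset.sum_sub_distrib, Finset.sum_add_distrib]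

lemma latticeLaplacian_comp_add {n : ℕ} (f : (Fin n → ℤ) → ℝ) (c x : Fin n → ℤ) :
    latticeLaplacian (fun y => f (y + c)) x = latticeLaplacian f (x + c) := by
  simp only [latticeLaplacian]
  refine Finset.sum_congr rfl fun i _ => ?_
  rw [add_right_comm, sub_add_eq_add_sub]

lemma latticeLaplacian_coord {n : ℕ} (k : Fin n) (x : Fin n → ℤ) :
    latticeLaplacian (fun y => (y k : ℝ)) x = 0 := by
  simp only [latticeLaplacian, Pi.add_apply, Pi.sub_apply]
  exact Finset.sum_eq_zero fun i _ => by push_cast; ring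

lemma latticeLaplacian_coord_sq {n : ℕ} (k : Fin n) (x : Fin n → ℤ) :
    latticeLaplacian (fun y => (y k : ℝ) ^ 2) x = 2 := by
  simp only [latticeLaplacian, Pi.add_apply, Pi.sub_apply]
  rw [Finset.sum_eq_single k]
  · simp; ring
  · intro i _ hi
    simp [Pi.single_eq_of_ne (Ne.symm hi)]; ring
  · simp

/-- The reflection `x_j ↦ -x_j`. -/
def coordReflection {n : ℕ} (j : Fin n) (x : Fin n → ℤ) : Fin n → ℤ :=
  Function.update x j (-x j)

lemma latticeLaplacian_comp_reflection {n : ℕ} (f : (Fin n → ℤ) → ℝ) (j : Fin n)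
    (x : Fin n → ℤ) :
    latticeLaplacian (fun y => f (coordReflection j y)) x =
      latticeLaplacian f (coordReflection j x) := by
  simp only [latticeLaplacian]
  refine Finset.sum_congr rfl fun i _ => ?_
  by_cases hi : i = j
  · subst hi
    have h1 : coordReflection i (x + Pi.single i 1) = coordReflection i x - Pi.single i 1 := by
      ext k
      by_cases hk : k = i
      · subst hk; simp [coordReflection]; ring
      · simp [coordReflection, hk]
    have h2 : coordReflection i (x - Pi.single i 1) = coordReflection i x + Pi.single i 1 := by
      ext k
      by_cases hk : k = i
      · subst hk; simp [coordReflection]; ring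
      · simp [coordReflection, hk]
    rw [h1, h2]; ring
  · have h1 : coordReflection j (x + Pi.single i 1) = coordReflection j x + Pi.single i 1 := by
      ext k
      by_cases hk : k = j
      · subst hk; simp [coordReflection, Pi.single_eq_of_ne (Ne.symm hi)]
      · simp [coordReflection, hk]
    have h2 : coordReflection j (x - Pi.single i 1) = coordReflection j x - Pi.single i 1 := by
      ext k
      by_cases hk : k = j
      · subst hk; simp [coordReflection, Pi.single_eq_of_ne (Ne.symm hi)]
      · simp [coordReflection, hk]
    rw [h1, h2]

/-! ### Maximum principle and gradient estimate. -/

/-- The maximum principle on a finite set of lattice points. -/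
lemma nonpos_of_latticeLaplacian_eq_zero {n : ℕ} (j : Fin n) (f : (Fin n → ℤ) → ℝ)
    (B : Finset (Fin n → ℤ)) (hf : ∀ x ∈ B, latticeLaplacian f x = 0)
    (hadd : ∀ x ∈ B, ∀ i, x + Pi.single i 1 ∉ B → f (x + Pi.single i 1) ≤ 0)
    (hsub : ∀ x ∈ B, ∀ i, x - Pi.single i 1 ∉ B → f (x - Pi.single i 1) ≤ 0) :
    ∀ x ∈ B, f x ≤ 0 := by
  by_contra! hcon
  obtain ⟨x₀, hx₀, hpos₀⟩ := hcon
  obtain ⟨x₁, hx₁, hmax⟩ := B.exists_max_image f ⟨x₀, hx₀⟩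
  have hpos : 0 < f x₁ := hpos₀.trans_le (hmax x₀ hx₀)
  -- Among the maximisers take one with largest `j`-th coordinate. Harmonicity makes its neighbour
  -- in direction `j` a maximiser too, a contradiction.
  obtain ⟨x, hx, hxj⟩ := (B.filter fun y => f y = f x₁).exists_max_image (fun y => y j)
    ⟨x₁, by simp [hx₁]⟩
  rw [Finset.mem_filter] at hx
  have hle : ∀ i, f (x + Pi.single i 1) ≤ f x := fun i => by
    by_cases h : x + Pi.single i 1 ∈ B
    · exact hx.2 ▸ hmax _ h
    · exact (hadd x hx.1 i h).trans (hx.2 ▸ hpos.le)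
  have hle' : ∀ i, f (x - Pi.single i 1) ≤ f x := fun i => by
    by_cases h : x - Pi.single i 1 ∈ B
    · exact hx.2 ▸ hmax _ h
    · exact (hsub x hx.1 i h).trans (hx.2 ▸ hpos.le)
  have hzero := (Finset.sum_eq_zero_iff_of_nonpos
    (fun i _ => by linarith [hle i, hle' i])).1 (hf x hx.1) j (Finset.mem_univ j)
  have heq : f (x + Pi.single j 1) = f x := by linarith [hle j, hle' j]
  have hmem : x + Pi.single j 1 ∈ B := by
    by_contra h
    linarith [hadd x hx.1 j h, hx.2]
  have := hxj (x + Pi.single j 1) (by rw [Finset.mem_filter]; exact ⟨hmem, heq.trans hx.2⟩)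
  simp at this

/-- A harmonic barrier on the half cube `0 ≤ x_j ≤ L`. -/
noncomputable def halfCubeBarrier {n : ℕ} (j : Fin n) (L : ℝ) (x : Fin n → ℤ) : ℝ :=
  ∑ k, (x k : ℝ) ^ 2 + (n * L * (x j : ℝ) - n * (x j : ℝ) ^ 2)

lemma latticeLaplacian_halfCubeBarrier {n : ℕ} (j : Fin n) (L : ℝ) (x : Fin n → ℤ) :
    latticeLaplacian (halfCubeBarrier j L) x = 0 := by
  unfold halfCubeBarrier
  rw [latticeLaplacian_add, latticeLaplacian_sum, latticeLaplacian_sub,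
    latticeLaplacian_const_mul, latticeLaplacian_const_mul, latticeLaplacian_coord,
    latticeLaplacian_coord_sq]
  simp only [latticeLaplacian_coord_sq]
  simp

lemma halfCubeBarrier_nonneg {n : ℕ} (j : Fin n) (L : ℝ) (x : Fin n → ℤ)
    (h0 : (0 : ℝ) ≤ x j) (hL : (x j : ℝ) ≤ L) : 0 ≤ halfCubeBarrier j L x := by
  have h1 : 0 ≤ ∑ k, (x k : ℝ) ^ 2 := Finset.sum_nonneg fun k _ => sq_nonneg _
  have h2 : 0 ≤ (n : ℝ) * ((x j : ℝ) * (L - x j)) := by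
    have := mul_nonneg h0 (sub_nonneg.2 hL); positivity
  unfold halfCubeBarrier; nlinarith

lemma sq_le_halfCubeBarrier {n : ℕ} (j i : Fin n) (L : ℝ) (x : Fin n → ℤ)
    (h0 : (0 : ℝ) ≤ x j) (hL : (x j : ℝ) ≤ L) (hi : (x i : ℝ) ^ 2 = L ^ 2) :
    L ^ 2 ≤ halfCubeBarrier j L x := by
  have h1 : (x i : ℝ) ^ 2 ≤ ∑ k, (x k : ℝ) ^ 2 :=
    Finset.single_le_sum (f := fun k => (x k : ℝ) ^ 2) (fun k _ => sq_nonneg _)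
      (Finset.mem_univ i)
  have h2 : 0 ≤ (n : ℝ) * ((x j : ℝ) * (L - x j)) := by
    have := mul_nonneg h0 (sub_nonneg.2 hL); positivity
  unfold halfCubeBarrier; nlinarith

/-- The odd part of `f` in `x_j` vanishes on `x_j = 0` and is at most `2M` on the other faces of the
half cube. There the barrier is at least `L²`, so `2M / L²` times it dominates the odd part; at `s
e_j` the barrier is at most `n L s`. -/
lemma sub_le_of_latticeLaplacian_eq_zero {n : ℕ} (j : Fin n) (f : (Fin n → ℤ) → ℝ) (M : ℝ)
    (L s : ℤ) (hs : 0 < s) (hsL : s < L)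
    (hf : ∀ x : Fin n → ℤ, (∀ i, |x i| < L) → latticeLaplacian f x = 0)
    (hM : ∀ x : Fin n → ℤ, (∀ i, |x i| ≤ L) → |f x| ≤ M) :
    f (Pi.single j s) - f (Pi.single j (-s)) ≤ 2 * n * M * s / L := by
  classical
  have hL : (0 : ℝ) < L := by exact_mod_cast hs.trans hsL
  have hM0 : 0 ≤ M := (abs_nonneg _).trans (hM 0 fun i => by simp; omega)
  let B : Finset (Fin n → ℤ) :=
    Fintype.piFinset fun i => if i = j then Finset.Ioo 0 L else Finset.Ioo (-L) L
  have hB : ∀ x, x ∈ B ↔ (∀ i, |x i| < L) ∧ 0 < x j := by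
    intro x
    simp only [B, Fintype.mem_piFinset]
    constructor
    · intro h
      refine ⟨fun i => ?_, ?_⟩
      · have := h i
        split_ifs at this with hi
        · rw [Finset.mem_Ioo] at this; rw [abs_lt]; omega
        · rw [Finset.mem_Ioo] at this; rw [abs_lt]; omega
      · have := h j
        rw [if_pos rfl, Finset.mem_Ioo] at this; exact this.1
    · rintro ⟨h, hj⟩ i
      have := abs_lt.1 (h i)
      split_ifs with hi
      · subst hi; rw [Finset.mem_Ioo]; omega
      · rw [Finset.mem_Ioo]; omega
  let g : (Fin n → ℤ) → ℝ := fun x =>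
    (f x - f (coordReflection j x)) - 2 * M / L ^ 2 * halfCubeBarrier j L x
  have hrefl : ∀ (x : Fin n → ℤ) i, |coordReflection j x i| = |x i| := by
    intro x i
    by_cases hi : i = j
    · subst hi; simp [coordReflection]
    · simp [coordReflection, hi]
  have hg : ∀ x ∈ B, latticeLaplacian g x = 0 := by
    intro x hx
    have hx' := (hB x).1 hx
    simp only [g]
    rw [latticeLaplacian_sub, latticeLaplacian_sub, latticeLaplacian_const_mul,
      latticeLaplacian_halfCubeBarrier, latticeLaplacian_comp_reflection, hf x hx'.1,
      hf _ fun i => by rw [hrefl]; exact hx'.1 i]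
    ring
  have hbd : ∀ y : Fin n → ℤ, (∀ i, |y i| ≤ L) → 0 ≤ y j → y ∉ B → g y ≤ 0 := by
    intro y hy h0 hyB
    have h0' : (0 : ℝ) ≤ y j := by exact_mod_cast h0
    have hyL : (y j : ℝ) ≤ L := by exact_mod_cast (le_abs_self _).trans (hy j)
    rcases h0.eq_or_lt with h | h
    · have h1 : coordReflection j y = y := by
        rw [coordReflection, ← h]; ext k
        by_cases hk : k = j
        · subst hk; simp [← h]
        · simp [hk]
      have := halfCubeBarrier_nonneg j L y h0' hyL
      simp only [g, h1, sub_self, zero_sub, Left.neg_nonpos_iff]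
      positivity
    · have h1 : ∃ i, |y i| = L := by
        by_contra! hne
        exact hyB ((hB y).2 ⟨fun i => lt_of_le_of_ne (hy i) (hne i), h⟩)
      obtain ⟨i, hi⟩ := h1
      have h2 := sq_le_halfCubeBarrier j i L y h0' hyL (by rw [← hi]; push_cast; rw [sq_abs])
      have h3 := abs_le.1 (hM y hy)
      have h4 := abs_le.1 (hM (coordReflection j y) fun i => by rw [hrefl]; exact hy i)
      have h5 : 2 * M ≤ 2 * M / L ^ 2 * halfCubeBarrier j L y := by
        calc 2 * M = 2 * M / L ^ 2 * (L : ℝ) ^ 2 := by field_simp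
          _ ≤ _ := by gcongr
      simp only [g]; linarith
  have key := nonpos_of_latticeLaplacian_eq_zero j g B hg ?_ ?_ (Pi.single j s) ?_
  · have h1 : coordReflection j (Pi.single j s) = Pi.single j (-s) := by
      ext k
      by_cases hk : k = j
      · subst hk; simp [coordReflection]
      · simp [coordReflection, hk]
    have h2 : halfCubeBarrier j L (Pi.single j s) ≤ n * L * s := by
      have h3 : ∑ k, (((Pi.single j s : Fin n → ℤ) k : ℤ) : ℝ) ^ 2 = (s : ℝ) ^ 2 := by
        rw [Finset.sum_eq_single j]
        · simp
        · intro k _ hk; simp [hk]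
        · simp
      have h4 : (1 : ℝ) ≤ n := by exact_mod_cast j.pos
      unfold halfCubeBarrier
      rw [h3]; simp only [Pi.single_eq_same]
      nlinarith [sq_nonneg (s : ℝ)]
    have h5 : 2 * M / L ^ 2 * halfCubeBarrier j L (Pi.single j s) ≤ 2 * n * M * s / L := by
      calc _ ≤ 2 * M / L ^ 2 * (n * L * s) := by gcongr
        _ = _ := by field_simp
    simp only [g, h1] at key
    linarith
  · intro x hx i hxi
    have hx' := (hB x).1 hx
    refine hbd _ (fun k => ?_) ?_ hxi
    · have := hx'.1 k
      by_cases hk : k = i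
      · subst hk; simp; rw [abs_lt] at this; rw [abs_le]; omega
      · simp [hk]; exact this.le
    · by_cases hk : j = i
      · subst hk; simp; omega
      · simp [hk]; omega
  · intro x hx i hxi
    have hx' := (hB x).1 hx
    refine hbd _ (fun k => ?_) ?_ hxi
    · have := hx'.1 k
      by_cases hk : k = i
      · subst hk; simp; rw [abs_lt] at this; rw [abs_le]; omega
      · simp [hk]; exact this.le
    · by_cases hk : j = i
      · subst hk; simp; omega
      · simp [hk]; omega
  · refine (hB _).2 ⟨fun i => ?_, by simpa using hs⟩
    by_cases hk : i = j
    · subst hk; simp; rw [abs_lt]; omega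
    · simp [hk]; omega

/-- Gradient estimate for the symmetric difference with step `s`. -/
lemma abs_sub_le_of_latticeLaplacian_eq_zero {n : ℕ} (j : Fin n) (f : (Fin n → ℤ) → ℝ) (M : ℝ)
    (L s : ℤ) (hsL : |s| < L) (c : Fin n → ℤ)
    (hf : ∀ x : Fin n → ℤ, (∀ i, |x i - c i| < L) → latticeLaplacian f x = 0)
    (hM : ∀ x : Fin n → ℤ, (∀ i, |x i - c i| ≤ L) → |f x| ≤ M) :
    |f (c + Pi.single j s) - f (c - Pi.single j s)| ≤ 2 * n * |(s : ℝ)| / L * M := by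
  have pos : ∀ t : ℤ, 0 < t → t < L →
      |f (c + Pi.single j t) - f (c - Pi.single j t)| ≤ 2 * n * t / L * M := by
    intro t ht htL
    have h1 := sub_le_of_latticeLaplacian_eq_zero j (fun x => f (x + c)) M L t ht htL
      (fun x hx => by
        rw [latticeLaplacian_comp_add]
        exact hf _ fun i => by simpa using hx i)
      (fun x hx => hM _ fun i => by simpa using hx i)
    have h2 := sub_le_of_latticeLaplacian_eq_zero j (fun x => -1 * f (x + c)) M L t ht htL
      (fun x hx => by
        rw [latticeLaplacian_const_mul, latticeLaplacian_comp_add,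
          hf _ fun i => by simpa using hx i, mul_zero])
      (fun x hx => by
        rw [neg_one_mul, abs_neg]
        exact hM _ fun i => by simpa using hx i)
    have e1 : Pi.single j t + c = c + Pi.single j t := add_comm _ _
    have e2 : Pi.single j (-t) + c = c - Pi.single j t := by
      rw [Pi.single_neg]; abel
    rw [e1, e2] at h1 h2
    have e3 : 2 * n * M * (t : ℝ) / L = 2 * n * t / L * M := by ring
    rw [e3] at h1 h2
    rw [abs_le]; constructor <;> linarith
  rcases lt_trichotomy s 0 with hs | hs | hs
  · have := pos (-s) (by omega) (by rw [abs_of_neg hs] at hsL; exact hsL)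
    rw [Pi.single_neg, ← sub_eq_add_neg, sub_neg_eq_add, abs_sub_comm] at this
    rw [abs_of_neg (by exact_mod_cast hs : (s : ℝ) < 0)]
    exact_mod_cast this
  · subst hs; simp
  · rw [abs_of_pos (by exact_mod_cast hs : (0 : ℝ) < s)]
    exact pos s hs (by rwa [abs_of_pos hs] at hsL)

/-! ### Iterated differences and extrapolation along a line. -/

/-- The forward difference of step `a` in direction `j`. -/
def coordDiff {n : ℕ} (j : Fin n) (a : ℤ) (f : (Fin n → ℤ) → ℝ) (x : Fin n → ℤ) : ℝ :=
  f (x + Pi.single j a) - f x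

lemma latticeLaplacian_coordDiff {n : ℕ} (j : Fin n) (a : ℤ) (f : (Fin n → ℤ) → ℝ)
    (x : Fin n → ℤ) :
    latticeLaplacian (coordDiff j a f) x =
      latticeLaplacian f (x + Pi.single j a) - latticeLaplacian f x := by
  have : coordDiff j a f = fun y => f (y + Pi.single j a) - f y := rfl
  rw [this, latticeLaplacian_sub, latticeLaplacian_comp_add]

/-- The step `2s` is even, so each difference is symmetric about the lattice point `x + s e_j` and
the gradient estimate applies on the cube of radius `L` there. As `|s| < L`, each difference costs
`2L` of the radius. -/
lemma abs_iterate_coordDiff_le {n : ℕ} (j : Fin n) (f : (Fin n → ℤ) → ℝ) (M : ℝ)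
    (R L s : ℤ) (hsL : |s| < L)
    (hf : ∀ x : Fin n → ℤ, (∀ i, |x i| < R) → latticeLaplacian f x = 0)
    (hM : ∀ x : Fin n → ℤ, (∀ i, |x i| ≤ R) → |f x| ≤ M) (k : ℕ) :
    (∀ x : Fin n → ℤ, (∀ i, |x i| < R - 2 * k * L) →
      latticeLaplacian ((coordDiff j (2 * s))^[k] f) x = 0) ∧
    ∀ x : Fin n → ℤ, (∀ i, |x i| ≤ R - 2 * k * L) →
      |(coordDiff j (2 * s))^[k] f x| ≤ (2 * n * |(s : ℝ)| / L) ^ k * M := by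
  have hL := (abs_nonneg s).trans_lt hsL
  have hsingle : ∀ (t : ℤ) (i : Fin n), |(Pi.single j t : Fin n → ℤ) i| ≤ |t| := by
    intro t i
    by_cases hi : i = j
    · subst hi; simp
    · simp [hi]
  induction k with
  | zero => simpa using ⟨hf, hM⟩
  | succ k ih =>
    obtain ⟨ih1, ih2⟩ := ih
    have hR : R - 2 * ((k + 1 : ℕ) : ℤ) * L = R - 2 * k * L - 2 * L := by push_cast; ring
    rw [hR]
    generalize R - 2 * (k : ℤ) * L = R' at *
    rw [Function.iterate_succ_apply']
    constructor
    · intro x hx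
      rw [latticeLaplacian_coordDiff, ih1 x fun i => by linarith [hx i], ih1, sub_self]
      intro i
      have h1 := hsingle (2 * s) i
      have h2 := abs_add_le (x i) ((Pi.single j (2 * s) : Fin n → ℤ) i)
      rw [abs_mul, abs_two] at h1
      rw [Pi.add_apply]; linarith [hx i]
    · intro x hx
      have hc : ∀ (y : Fin n → ℤ) i, |y i| ≤ |y i - (x + Pi.single j s : Fin n → ℤ) i| + |x i| + |s| := by
        intro y i
        have h1 := hsingle s i
        have h2 := abs_add_le (x i) ((Pi.single j s : Fin n → ℤ) i)
        have h3 := abs_add_le (y i - (x + Pi.single j s : Fin n → ℤ) i)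
          ((x + Pi.single j s : Fin n → ℤ) i)
        rw [sub_add_cancel] at h3
        rw [Pi.add_apply] at *; linarith
      have := abs_sub_le_of_latticeLaplacian_eq_zero j ((coordDiff j (2 * s))^[k] f)
        ((2 * n * |(s : ℝ)| / L) ^ k * M) L s hsL (x + Pi.single j s)
        (fun y hy => ih1 y fun i => by linarith [hc y i, hy i, hx i])
        (fun y hy => ih2 y fun i => by linarith [hc y i, hy i, hx i])
      rw [add_sub_cancel_right, add_assoc, ← Pi.single_add, ← two_mul] at this
      rw [coordDiff, pow_succ', mul_assoc]
      exact this

/-- Think of `A i k` as the `k`-th difference at node `i`. Small values at the first `d + 1` nodes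
control the row `i = 0`; then `A (i+1) k = A i k + A i (k+1)` advances `i`, the order-`d`
differences closing the recursion. -/
lemma abs_le_of_difference_triangle (A : ℕ → ℕ → ℝ) (d : ℕ) (ε η : ℝ)
    (hA : ∀ i k, A i (k + 1) = A (i + 1) k - A i k)
    (hε : ∀ i ≤ d, |A i 0| ≤ ε) (hη : ∀ i ≤ 2 * d, |A i d| ≤ η) :
    |A (2 * d) 0| ≤ 9 ^ d * ε + 4 ^ d * η := by
  have hε0 : 0 ≤ ε := (abs_nonneg _).trans (hε 0 (Nat.zero_le _))
  have hη0 : 0 ≤ η := (abs_nonneg _).trans (hη 0 (Nat.zero_le _))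
  have h1 : ∀ k i, i + k ≤ d → |A i k| ≤ 2 ^ k * ε := by
    intro k
    induction k with
    | zero => intro i hi; simpa using hε i hi
    | succ k ih =>
      intro i hi
      have := abs_sub (A (i + 1) k) (A i k)
      rw [hA, pow_succ]
      linarith [ih i (by omega), ih (i + 1) (by omega)]
  -- The weight `3^i 2^k` is reproduced exactly: `3^i 2^k + 3^i 2^(k+1) = 3^(i+1) 2^k`.
  have h2 : ∀ i ≤ 2 * d, ∀ k ≤ d, |A i k| ≤ 3 ^ i * 2 ^ k * ε + 2 ^ i * η := by
    intro i
    induction i with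
    | zero =>
      intro _ k hk
      have := h1 k 0 (by omega)
      simp only [pow_zero, one_mul]; linarith
    | succ i ih =>
      intro hi k hk
      rcases hk.eq_or_lt with rfl | hk
      · have h3 := hη (i + 1) hi
        have h4 : (1 : ℝ) ≤ 2 ^ (i + 1) := one_le_pow₀ (by norm_num)
        have h5 : 0 ≤ (3 : ℝ) ^ (i + 1) * 2 ^ k * ε := by positivity
        nlinarith
      · have e : A (i + 1) k = A i k + A i (k + 1) := by rw [hA]; ring
        have := abs_add_le (A i k) (A i (k + 1))
        have h3 := ih (by omega) k hk.le
        have h4 := ih (by omega) (k + 1) hk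
        rw [e]
        rw [pow_succ] at *
        calc _ ≤ _ := this
          _ ≤ _ := add_le_add h3 h4
          _ = _ := by ring
  have := h2 (2 * d) le_rfl 0 (Nat.zero_le _)
  rwa [pow_mul, pow_mul, pow_zero, mul_one, show (3 : ℝ) ^ 2 = 9 by norm_num,
    show (2 : ℝ) ^ 2 = 4 by norm_num] at this

/-- Values on a line, extrapolated from a short lattice segment by finite differences. -/
lemma abs_le_pow_of_small_on_segment {n : ℕ} (j : Fin n) (f : (Fin n → ℤ) → ℝ) (M ε : ℝ)
    (m d : ℕ) (hd : 0 < d) (hdm : 2 * d ≤ m)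
    (hf : ∀ x : Fin n → ℤ, (∀ i, |x i| < (16 * n + 2) * m) → latticeLaplacian f x = 0)
    (hM : ∀ x : Fin n → ℤ, (∀ i, |x i| ≤ (16 * n + 2) * m) → |f x| ≤ M)
    (y : Fin n → ℤ) (hy : ∀ i, 2 * |y i| ≤ 3 * m) (hyj : (m : ℤ) < |y j|)
    (hε : ∀ b : ℤ, |b| ≤ m → |f (Function.update y j b)| ≤ ε) :
    |f y| ≤ 9 ^ d * ε + (1 / 2) ^ d * M := by
  obtain ⟨τ, hτ, hyτ⟩ : ∃ τ : ℤ, |τ| = 1 ∧ y j = τ * |y j| := by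
    rcases le_total 0 (y j) with h | h
    · exact ⟨1, by simp, by rw [abs_of_nonneg h]; ring⟩
    · exact ⟨-1, by simp, by rw [abs_of_nonpos h]; ring⟩
  obtain ⟨s, hs, hs1, hs2⟩ : ∃ s : ℕ, 0 < s ∧ 2 * d * s ≤ m ∧ m ≤ 4 * d * s := by
    refine ⟨m / (2 * d), Nat.div_pos hdm (by omega), Nat.mul_div_le _ _, ?_⟩
    have h1 : 0 < m / (2 * d) := Nat.div_pos hdm (by omega)
    have h2 := Nat.lt_mul_div_succ m (show 0 < 2 * d by omega)
    nlinarith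
  have hn : (1 : ℤ) ≤ n := by exact_mod_cast j.pos
  have hs1' : 2 * (d : ℤ) * s ≤ m := by exact_mod_cast hs1
  have hs2' : (m : ℤ) ≤ 4 * d * s := by exact_mod_cast hs2
  have hs' : (0 : ℤ) < s := by exact_mod_cast hs
  have hM0 : 0 ≤ M := (abs_nonneg _).trans (hM 0 fun i => by simp; positivity)
  -- The `2d + 1` nodes have spacing `2s` and end at `y`. Since `m ≤ 4ds` and `2ds ≤ m`, the nodes
  -- with `i ≤ d` lie on the segment `|x_j| ≤ m`.
  let p : ℕ → Fin n → ℤ := fun i => Function.update y j (τ * (|y j| - 2 * s * (2 * d - i)))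
  have hp : ∀ i, p (i + 1) = p i + Pi.single j (2 * (τ * s)) := by
    intro i; ext k
    by_cases hk : k = j
    · subst hk; simp [p]; ring
    · simp [p, hk]
  have hend : p (2 * d) = y := by
    simp only [p]
    push_cast
    rw [sub_self, mul_zero, sub_zero, ← hyτ, Function.update_eq_self]
  have hnm : (m : ℤ) ≤ n * m := le_mul_of_one_le_left (by positivity) hn
  have hyj2 := hy j
  have hpbd : ∀ i ≤ 2 * d, ∀ k, |p i k| ≤ 2 * m := by
    intro i hi k
    by_cases hk : k = j
    · subst hk
      have hi' : (i : ℤ) ≤ 2 * d := by exact_mod_cast hi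
      simp only [p, Function.update_self]
      rw [abs_mul, hτ, one_mul, abs_le]
      have h1 : 0 ≤ (s : ℤ) * (2 * d - i) := mul_nonneg hs'.le (by linarith)
      have h2 : 0 ≤ (s : ℤ) * i := by positivity
      constructor <;> linarith
    · simp only [p, Function.update_of_ne hk]
      linarith [hy k, abs_nonneg (y k)]
  -- The radius `L = 16ns` makes each factor `1/8`, beating the `4^d` of the triangle. The total
  -- loss `2dL ≤ 16nm` leaves radius `2m`, which contains all nodes.
  have hit := abs_iterate_coordDiff_le j f M ((16 * n + 2) * m) (16 * n * s) (τ * s)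
    (by rw [abs_mul, hτ, one_mul, abs_of_pos hs']; nlinarith) hf hM d
  have key := abs_le_of_difference_triangle
    (fun i k => (coordDiff j (2 * (τ * s)))^[k] f (p i)) d ε ((1 / 8) ^ d * M)
    (fun i k => by simp only [hp, Function.iterate_succ_apply', coordDiff])
    (fun i hi => ?_) (fun i hi => ?_)
  · simp only [hend, Function.iterate_zero, id_eq] at key
    rw [← mul_assoc, ← mul_pow] at key
    norm_num at key ⊢
    exact key
  · simp only [Function.iterate_zero, id_eq]
    apply hε
    have hi' : (i : ℤ) ≤ d := by exact_mod_cast hi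
    rw [abs_mul, hτ, one_mul, abs_le]
    have h1 : 0 ≤ (s : ℤ) * (d - i) := mul_nonneg hs'.le (by linarith)
    have h2 : 0 ≤ (s : ℤ) * i := by positivity
    constructor <;> linarith
  · have h1 := hit.2 (p i) fun k => (hpbd i hi k).trans (by
      have := mul_le_mul_of_nonneg_left hs1' (show (0 : ℤ) ≤ 16 * n by positivity)
      linarith)
    have h2 : 2 * (n : ℝ) * |((τ * s : ℤ) : ℝ)| / ((16 * n * s : ℤ) : ℝ) = 1 / 8 := by
      have h3 : |((τ * s : ℤ) : ℝ)| = s := by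
        rw [← Int.cast_abs, abs_mul, hτ, one_mul, abs_of_pos hs']; simp
      have h4 : (0 : ℝ) < n := by exact_mod_cast j.pos
      have h5 : (0 : ℝ) < s := by exact_mod_cast hs
      rw [h3]; push_cast; field_simp; norm_num
    rwa [h2] at h1

/-! ### Hölder bounds with exponential error, and smallness on cubes. -/

/-- Optimisation over the order of the differences. -/
lemma le_rpow_add_exp_of_forall_pow (X t M : ℝ) (m : ℕ) (ht : 0 ≤ t) (hM : 0 ≤ M)
    (hXM : X ≤ M) (hX : ∀ d : ℕ, 2 * d ≤ m → X ≤ 9 ^ d * (t * M) + (1 / 2) ^ d * M) :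
    X ≤ 3 * (t ^ (1 / 12 : ℝ) + Real.exp (-(1 / 12) * m)) * M := by
  have hexp1 : Real.exp (1 / 2) ≤ 2 := by
    have h := Real.exp_one_lt_d9
    have h2 : Real.exp (1 / 2) ^ 2 = Real.exp 1 := by
      rw [← Real.exp_nat_mul]; norm_num
    nlinarith [Real.exp_pos (1 / 2)]
  rcases le_or_gt 1 t with h1 | h1
  · have h2 : 1 ≤ t ^ (1 / 12 : ℝ) := Real.one_le_rpow h1 (by norm_num)
    have h3 := Real.exp_pos (-(1 / 12) * (m : ℝ))
    nlinarith
  -- Truncating `t` at `e^{-m}` keeps `l = -log t'` at most `m`, so that `d = ⌊l/6⌋` is admissible.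
  set t' := max t (Real.exp (-m)) with ht'
  have htpos : 0 < t' := lt_max_of_lt_right (Real.exp_pos _)
  have ht1 : t' ≤ 1 := max_le h1.le (Real.exp_le_one_iff.2 (by simp))
  set l := -Real.log t' with hl
  have hl0 : 0 ≤ l := by
    have := Real.log_nonpos htpos.le ht1; linarith
  have hlm : l ≤ m := by
    have := Real.log_le_log (Real.exp_pos _) (le_max_right t (Real.exp (-m)))
    rw [Real.log_exp] at this; linarith
  have htl : t' = Real.exp (-l) := by rw [hl, neg_neg, Real.exp_log htpos]
  have hmain : X ≤ 3 * t' ^ (1 / 12 : ℝ) * M := by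
    have hfl := Nat.floor_le (show 0 ≤ l / 6 by positivity)
    have hfl2 := Nat.lt_floor_add_one (l / 6)
    set d := ⌊l / 6⌋₊ with hd
    have hdm : 2 * d ≤ m := by
      have : (2 : ℝ) * d ≤ m := by linarith
      exact_mod_cast this
    -- With `9 ≤ e^3` and `d ≤ l/6` the first term is at most `e^{-l/2}`. The second, from `1/2 ≤
    -- e^{-1/2}`, is about `e^{-l/12}` and fixes the exponent `1/12`.
    have h9 : (9 : ℝ) ^ d * t' ≤ t' ^ (1 / 12 : ℝ) := by
      have e9 : (9 : ℝ) ≤ Real.exp 3 := by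
        have h := Real.exp_one_gt_d9
        have h2 : Real.exp 1 ^ 3 = Real.exp 3 := by rw [← Real.exp_nat_mul]; norm_num
        rw [← h2]
        calc (9 : ℝ) ≤ 2.5 ^ 3 := by norm_num
          _ ≤ _ := by gcongr; linarith
      calc (9 : ℝ) ^ d * t' ≤ Real.exp 3 ^ d * t' := by gcongr
        _ = Real.exp (d * 3 - l) := by rw [← Real.exp_nat_mul, htl, ← Real.exp_add]; rfl
        _ ≤ Real.exp (-l * (1 / 12)) := Real.exp_le_exp.2 (by linarith)
        _ = _ := by rw [htl, Real.exp_mul]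
    have h2 : (1 / 2 : ℝ) ^ d ≤ 2 * t' ^ (1 / 12 : ℝ) := by
      have e2 : (1 / 2 : ℝ) ≤ Real.exp (-(1 / 2)) := by
        have h := inv_anti₀ (Real.exp_pos _) hexp1
        rwa [← Real.exp_neg, ← one_div] at h
      calc (1 / 2 : ℝ) ^ d ≤ Real.exp (-(1 / 2)) ^ d := by gcongr
        _ = Real.exp (d * (-(1 / 2))) := by rw [← Real.exp_nat_mul]
        _ ≤ Real.exp (1 / 2 + -l * (1 / 12)) := Real.exp_le_exp.2 (by linarith)
        _ = Real.exp (1 / 2) * Real.exp (-l * (1 / 12)) := Real.exp_add _ _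
        _ ≤ 2 * Real.exp (-l * (1 / 12)) := by gcongr
        _ = _ := by rw [htl, Real.exp_mul]
    calc X ≤ 9 ^ d * (t * M) + (1 / 2) ^ d * M := hX d hdm
      _ ≤ 9 ^ d * (t' * M) + (1 / 2) ^ d * M := by gcongr; exact le_max_left _ _
      _ = (9 ^ d * t' + (1 / 2) ^ d) * M := by ring
      _ ≤ (t' ^ (1 / 12 : ℝ) + 2 * t' ^ (1 / 12 : ℝ)) * M := by gcongr
      _ = _ := by ring
  refine hmain.trans ?_
  gcongr
  rcases max_choice t (Real.exp (-m)) with h | h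
  · rw [ht', h]; linarith [Real.exp_pos (-(1 / 12) * m)]
  · rw [ht', h, ← Real.exp_mul]
    have : -(m : ℝ) * (1 / 12) = -(1 / 12) * m := by ring
    rw [this]; linarith [Real.rpow_nonneg ht (1 / 12)]

/-- Composition of two Hölder type bounds with exponential error. -/
lemma rpow_add_exp_comp_le (C₁ C₂ α₁ α₂ c₁ c₂ t x : ℝ) (hC₁ : 1 ≤ C₁) (hC₂ : 1 ≤ C₂)
    (hα₂ : 0 < α₂) (hα₂' : α₂ ≤ 1) (ht : 0 ≤ t) (hx : 0 ≤ x) :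
    C₂ * ((C₁ * (t ^ α₁ + Real.exp (-c₁ * x))) ^ α₂ + Real.exp (-c₂ * x)) ≤
      2 * C₁ * C₂ * (t ^ (α₁ * α₂) + Real.exp (-min (c₁ * α₂) c₂ * x)) := by
  have h0 : 0 ≤ t ^ α₁ := Real.rpow_nonneg ht _
  have h1 : (C₁ * (t ^ α₁ + Real.exp (-c₁ * x))) ^ α₂ ≤
      C₁ * (t ^ (α₁ * α₂) + Real.exp (-min (c₁ * α₂) c₂ * x)) := by
    rw [Real.mul_rpow (by linarith) (by positivity)]
    have h2 : C₁ ^ α₂ ≤ C₁ := by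
      simpa using Real.rpow_le_rpow_of_exponent_le hC₁ hα₂'
    have h3 := Real.rpow_add_le_add_rpow h0 (Real.exp_pos (-c₁ * x)).le hα₂.le hα₂'
    rw [← Real.rpow_mul ht, ← Real.exp_mul] at h3
    have h4 : Real.exp (-c₁ * x * α₂) ≤ Real.exp (-min (c₁ * α₂) c₂ * x) := by
      refine Real.exp_le_exp.2 ?_
      have := mul_le_mul_of_nonneg_right (min_le_left (c₁ * α₂) c₂) hx
      linarith
    have := h3.trans (add_le_add_right h4 _)
    gcongr
  have h5 : Real.exp (-c₂ * x) ≤ Real.exp (-min (c₁ * α₂) c₂ * x) := by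
    refine Real.exp_le_exp.2 ?_
    have := mul_le_mul_of_nonneg_right (min_le_right (c₁ * α₂) c₂) hx
    linarith
  have h6 : 0 ≤ t ^ (α₁ * α₂) := Real.rpow_nonneg ht _
  set E := Real.exp (-min (c₁ * α₂) c₂ * x)
  have hE : 0 < E := Real.exp_pos _
  have h7 : E ≤ C₁ * (t ^ (α₁ * α₂) + E) := by nlinarith
  calc _ ≤ C₂ * (C₁ * (t ^ (α₁ * α₂) + E) + C₁ * (t ^ (α₁ * α₂) + E)) := by
        gcongr; linarith
    _ = _ := by ring

lemma abs_le_of_small_on_segment {n : ℕ} (j : Fin n) (f : (Fin n → ℤ) → ℝ) (M t : ℝ)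
    (m : ℕ) (ht : 0 ≤ t)
    (hf : ∀ x : Fin n → ℤ, (∀ i, |x i| < (16 * n + 2) * m) → latticeLaplacian f x = 0)
    (hM : ∀ x : Fin n → ℤ, (∀ i, |x i| ≤ (16 * n + 2) * m) → |f x| ≤ M)
    (y : Fin n → ℤ) (hy : ∀ i, 2 * |y i| ≤ 3 * m)
    (hε : ∀ b : ℤ, |b| ≤ m → |f (Function.update y j b)| ≤ t * M) :
    |f y| ≤ 3 * (t ^ (1 / 12 : ℝ) + Real.exp (-(1 / 12) * m)) * M := by
  have hM0 : 0 ≤ M := (abs_nonneg _).trans (hM 0 fun i => by simp; positivity)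
  have h1 := hM y fun i => by
    have : 0 ≤ (n : ℤ) * m := by positivity
    linarith [hy i, abs_nonneg (y i)]
  have h2 : 0 ≤ t * M := mul_nonneg ht hM0
  refine le_rpow_add_exp_of_forall_pow _ t M m ht hM0 h1 fun d hd => ?_
  rcases le_or_gt |y j| m with hyj | hyj
  · have h3 := hε (y j) hyj
    rw [Function.update_eq_self] at h3
    have h4 : t * M ≤ 9 ^ d * (t * M) := le_mul_of_one_le_left h2 (one_le_pow₀ (by norm_num))
    have h5 : 0 ≤ (1 / 2 : ℝ) ^ d * M := by positivity
    linarith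
  rcases d.eq_zero_or_pos with rfl | hd0
  · simp only [pow_zero]; linarith
  · exact abs_le_pow_of_small_on_segment j f M (t * M) m d hd0 hd hf hM y hy hyj hε

/-- Propagation of smallness from a lattice cube of radius `m` to the cube of radius `3m/2`. -/
lemma exists_abs_le_of_small_on_cube (n : ℕ) :
    ∃ C α c : ℝ, 1 ≤ C ∧ 0 < α ∧ α < 1 ∧ 0 < c ∧
      ∀ (f : (Fin n → ℤ) → ℝ) (M t : ℝ) (m : ℕ), 0 ≤ t →
      (∀ x : Fin n → ℤ, (∀ i, |x i| < (16 * n + 2) * m) → latticeLaplacian f x = 0) →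
      (∀ x : Fin n → ℤ, (∀ i, |x i| ≤ (16 * n + 2) * m) → |f x| ≤ M) →
      (∀ x : Fin n → ℤ, (∀ i, |x i| ≤ m) → |f x| ≤ t * M) →
      ∀ x : Fin n → ℤ, (∀ i, 2 * |x i| ≤ 3 * m) →
        |f x| ≤ C * (t ^ α + Real.exp (-c * m)) * M := by
  classical
  -- `T` is the set of coordinates already allowed to reach `3m/2`; the others stay within `m`.
  suffices H : ∀ T : Finset (Fin n), ∃ C α c : ℝ, 1 ≤ C ∧ 0 < α ∧ α < 1 ∧ 0 < c ∧
      ∀ (f : (Fin n → ℤ) → ℝ) (M t : ℝ) (m : ℕ), 0 ≤ t →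
      (∀ x : Fin n → ℤ, (∀ i, |x i| < (16 * n + 2) * m) → latticeLaplacian f x = 0) →
      (∀ x : Fin n → ℤ, (∀ i, |x i| ≤ (16 * n + 2) * m) → |f x| ≤ M) →
      (∀ x : Fin n → ℤ, (∀ i, |x i| ≤ m) → |f x| ≤ t * M) →
      ∀ x : Fin n → ℤ, (∀ i, 2 * |x i| ≤ 3 * m) → (∀ i ∉ T, |x i| ≤ m) →
        |f x| ≤ C * (t ^ α + Real.exp (-c * m)) * M by
    obtain ⟨C, α, c, hC, hα, hα1, hc, h⟩ := H Finset.univ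
    exact ⟨C, α, c, hC, hα, hα1, hc, fun f M t m h0 h2 h3 h4 x hx =>
      h f M t m h0 h2 h3 h4 x hx fun i hi => absurd (Finset.mem_univ i) hi⟩
  intro T
  induction T using Finset.induction_on with
  | empty =>
    refine ⟨1, 1 / 2, 1, le_rfl, by norm_num, by norm_num, by norm_num, ?_⟩
    intro f M t m h0 _ hM hs x hx hT
    have hM0 : 0 ≤ M := (abs_nonneg _).trans (hM 0 fun i => by simp; positivity)
    have hE := Real.exp_pos (-1 * (m : ℝ))
    rcases le_total t 1 with h1 | h1
    · refine (hs x fun i => hT i (by simp)).trans ?_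
      have h2 : t ≤ t ^ (1 / 2 : ℝ) := by
        simpa using Real.rpow_le_rpow_of_exponent_ge' h0 h1 (by norm_num : (0 : ℝ) ≤ 1 / 2)
          (by norm_num : (1 / 2 : ℝ) ≤ 1)
      gcongr
      linarith
    · have h2 : 1 ≤ t ^ (1 / 2 : ℝ) := Real.one_le_rpow h1 (by norm_num)
      have h3 := hM x fun i => by
        have : 0 ≤ (n : ℤ) * m := by positivity
        linarith [hx i, abs_nonneg (x i)]
      nlinarith
  | insert j T hj ih =>
    obtain ⟨C, α, c, hC, hα, hα1, hc, h⟩ := ih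
    refine ⟨2 * C * 3, α * (1 / 12), min (c * (1 / 12)) (1 / 12), by linarith, by positivity,
      by linarith, by positivity, ?_⟩
    intro f M t m h0 hf hM hs x hx hT
    have hM0 : 0 ≤ M := (abs_nonneg _).trans (hM 0 fun i => by simp; positivity)
    have hcomp := rpow_add_exp_comp_le C 3 α (1 / 12) c (1 / 12) t m hC (by norm_num)
      (by norm_num) (by norm_num) h0 (by positivity)
    refine le_trans ?_ (mul_le_mul_of_nonneg_right hcomp hM0)
    have ht' : 0 ≤ C * (t ^ α + Real.exp (-c * m)) := by
      have := Real.rpow_nonneg h0 α; positivity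
    have hup : ∀ b : ℤ, |b| ≤ m → |f (Function.update x j b)| ≤
        C * (t ^ α + Real.exp (-c * m)) * M := by
      intro b hb
      refine h f M t m h0 hf hM hs _ (fun i => ?_) (fun i hi => ?_)
      · by_cases hij : i = j
        · subst hij; simp only [Function.update_self]; linarith
        · simpa only [Function.update_of_ne hij] using hx i
      · by_cases hij : i = j
        · subst hij; simpa only [Function.update_self] using hb
        · simpa only [Function.update_of_ne hij] using
            hT i (by simp [hij, hi])
    exact abs_le_of_small_on_segment j f M _ m ht' hf hM x hx hup

/-! ### Propagation relation between subsets of the domain. -/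

/-- Smallness of discrete harmonic functions on `O` propagates from `O` to `V`. -/
def PropagatesTo {n : ℕ} (Ω O V : Set (Fin n → ℝ)) : Prop :=
  ∃ (C α c : ℝ) (N₀ : ℕ), 1 ≤ C ∧ 0 < α ∧ α < 1 ∧ 0 < c ∧
    ∀ N : ℕ, N₀ < N → ∀ u : (Fin n → ℝ) → ℝ,
      IsDiscreteHarmonicOn (N : ℝ)⁻¹ u Ω → BddAbove (absValues (N : ℝ)⁻¹ u Ω) →
      ∀ x ∈ discretize (N : ℝ)⁻¹ V,
        |u x| ≤ C * ((latticeMax (N : ℝ)⁻¹ u O / latticeMax (N : ℝ)⁻¹ u Ω) ^ α +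
          Real.exp (-c * N)) * latticeMax (N : ℝ)⁻¹ u Ω

lemma latticeMax_nonneg {n : ℕ} (h : ℝ) (u : (Fin n → ℝ) → ℝ) (E : Set (Fin n → ℝ)) :
    0 ≤ latticeMax h u E :=
  Real.sSup_nonneg (by rintro _ ⟨x, _, rfl⟩; exact abs_nonneg _)

lemma abs_le_latticeMax {n : ℕ} {h : ℝ} {u : (Fin n → ℝ) → ℝ} {E : Set (Fin n → ℝ)}
    (hb : BddAbove (absValues h u E)) {x : Fin n → ℝ} (hx : x ∈ discretize h E) :
    |u x| ≤ latticeMax h u E :=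
  le_csSup hb ⟨x, hx, rfl⟩

lemma absValues_mono {n : ℕ} {h : ℝ} {u : (Fin n → ℝ) → ℝ} {E F : Set (Fin n → ℝ)}
    (hEF : E ⊆ F) : absValues h u E ⊆ absValues h u F :=
  Set.image_mono (Set.inter_subset_inter_left _ hEF)

lemma latticeMax_mono {n : ℕ} {h : ℝ} {u : (Fin n → ℝ) → ℝ} {E F : Set (Fin n → ℝ)}
    (hEF : E ⊆ F) (hb : BddAbove (absValues h u F)) : latticeMax h u E ≤ latticeMax h u F := by
  refine Real.sSup_le ?_ (latticeMax_nonneg h u F)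
  rintro _ ⟨x, hx, rfl⟩
  exact abs_le_latticeMax hb ⟨hEF hx.1, hx.2⟩

lemma latticeMax_div_nonneg {n : ℕ} (h : ℝ) (u : (Fin n → ℝ) → ℝ) (O Ω : Set (Fin n → ℝ)) :
    0 ≤ latticeMax h u O / latticeMax h u Ω :=
  div_nonneg (latticeMax_nonneg _ _ _) (latticeMax_nonneg _ _ _)

lemma latticeMax_div_le_one {n : ℕ} {h : ℝ} {u : (Fin n → ℝ) → ℝ} {O Ω : Set (Fin n → ℝ)}
    (hO : O ⊆ Ω) (hb : BddAbove (absValues h u Ω)) :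
    latticeMax h u O / latticeMax h u Ω ≤ 1 :=
  div_le_one_of_le₀ (latticeMax_mono hO hb) (latticeMax_nonneg _ _ _)

lemma PropagatesTo.mono {n : ℕ} {Ω O V W : Set (Fin n → ℝ)} (hV : PropagatesTo Ω O V)
    (hWV : W ⊆ V) : PropagatesTo Ω O W := by
  obtain ⟨C, α, c, N₀, hC, hα, hα1, hc, h⟩ := hV
  exact ⟨C, α, c, N₀, hC, hα, hα1, hc, fun N hN u hu hb x hx =>
    h N hN u hu hb x ⟨hWV hx.1, hx.2⟩⟩

lemma propagatesTo_self {n : ℕ} {Ω O : Set (Fin n → ℝ)} (hO : O ⊆ Ω) : PropagatesTo Ω O O := by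
  refine ⟨1, 1 / 2, 1, 0, le_rfl, by norm_num, by norm_num, by norm_num, ?_⟩
  intro N _ u _ hb x hx
  have h1 := abs_le_latticeMax (hb.mono (absValues_mono hO)) hx
  have h2 := latticeMax_mono hO hb
  have hΩ := latticeMax_nonneg (N : ℝ)⁻¹ u Ω
  have ht := latticeMax_div_nonneg (N : ℝ)⁻¹ u O Ω
  have ht1 := latticeMax_div_le_one hO hb
  have h3 := Real.rpow_le_rpow_of_exponent_ge' ht ht1 (by norm_num : (0 : ℝ) ≤ 1 / 2)
    (by norm_num : (1 / 2 : ℝ) ≤ 1)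
  rw [Real.rpow_one] at h3
  -- If the maximum over `Ω` is `0` the quotient is a junk value, but `u` vanishes on the lattice
  -- points of `O`.
  rcases hΩ.eq_or_lt with h | h
  · rw [← h, mul_zero]; linarith
  · calc |u x| ≤ latticeMax (N : ℝ)⁻¹ u O := h1
      _ = latticeMax (N : ℝ)⁻¹ u O / latticeMax (N : ℝ)⁻¹ u Ω * latticeMax (N : ℝ)⁻¹ u Ω := by
        rw [div_mul_cancel₀ _ h.ne']
      _ ≤ _ := by
        gcongr
        linarith [Real.exp_pos (-1 * (N : ℝ))]

lemma PropagatesTo.union {n : ℕ} {Ω O V W : Set (Fin n → ℝ)} (hO : O ⊆ Ω)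
    (hV : PropagatesTo Ω O V) (hW : PropagatesTo Ω O W) : PropagatesTo Ω O (V ∪ W) := by
  obtain ⟨C₁, α₁, c₁, N₁, hC₁, hα₁, hα₁', hc₁, h₁⟩ := hV
  obtain ⟨C₂, α₂, c₂, N₂, hC₂, hα₂, hα₂', hc₂, h₂⟩ := hW
  refine ⟨max C₁ C₂, min α₁ α₂, min c₁ c₂, max N₁ N₂, le_max_of_le_left hC₁, lt_min hα₁ hα₂,
    min_lt_of_left_lt hα₁', lt_min hc₁ hc₂, ?_⟩
  intro N hN u hu hb x hx
  have hΩ := latticeMax_nonneg (N : ℝ)⁻¹ u Ω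
  have ht := latticeMax_div_nonneg (N : ℝ)⁻¹ u O Ω
  have ht1 := latticeMax_div_le_one hO hb
  -- The quotient is at most `1`, so lowering the exponent only weakens the bound.
  have key : ∀ C α c : ℝ, 1 ≤ C → C ≤ max C₁ C₂ → min α₁ α₂ ≤ α → min c₁ c₂ ≤ c →
      C * ((latticeMax (N : ℝ)⁻¹ u O / latticeMax (N : ℝ)⁻¹ u Ω) ^ α + Real.exp (-c * N)) *
        latticeMax (N : ℝ)⁻¹ u Ω ≤
      max C₁ C₂ * ((latticeMax (N : ℝ)⁻¹ u O / latticeMax (N : ℝ)⁻¹ u Ω) ^ min α₁ α₂ +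
        Real.exp (-min c₁ c₂ * N)) * latticeMax (N : ℝ)⁻¹ u Ω := by
    intro C α c h1 hC hα hc
    have h2 := Real.rpow_le_rpow_of_exponent_ge' ht ht1 (lt_min hα₁ hα₂).le hα
    have h3 := Real.rpow_nonneg ht α
    gcongr
  rcases hx.1 with hxV | hxW
  · exact (h₁ N ((le_max_left _ _).trans_lt hN) u hu hb x ⟨hxV, hx.2⟩).trans
      (key _ _ _ hC₁ (le_max_left _ _) (min_le_left _ _) (min_le_left _ _))
  · exact (h₂ N ((le_max_right _ _).trans_lt hN) u hu hb x ⟨hxW, hx.2⟩).trans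
      (key _ _ _ hC₂ (le_max_right _ _) (min_le_right _ _) (min_le_right _ _))

/-! ### From lattice cubes to balls. -/

/-- The point of `(hℤ)ⁿ` with integer coordinates `z`. -/
noncomputable def latticePoint {n : ℕ} (h : ℝ) (z : Fin n → ℤ) : Fin n → ℝ :=
  fun i => h * z i

lemma latticePoint_add_single {n : ℕ} (h : ℝ) (z : Fin n → ℤ) (i : Fin n) :
    latticePoint h (z + Pi.single i 1) = latticePoint h z + h • Pi.single i (1 : ℝ) := by
  ext k
  by_cases hk : k = i
  · subst hk; simp [latticePoint]; ring
  · simp [latticePoint, hk]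

lemma latticePoint_sub_single {n : ℕ} (h : ℝ) (z : Fin n → ℤ) (i : Fin n) :
    latticePoint h (z - Pi.single i 1) = latticePoint h z - h • Pi.single i (1 : ℝ) := by
  ext k
  by_cases hk : k = i
  · subst hk; simp [latticePoint]; ring
  · simp [latticePoint, hk]

lemma latticePoint_mem_discretize {n : ℕ} {h : ℝ} {E : Set (Fin n → ℝ)} {z : Fin n → ℤ}
    (hz : latticePoint h z ∈ E) : latticePoint h z ∈ discretize h E :=
  ⟨hz, fun i => ⟨z i, rfl⟩⟩

lemma latticeLaplacian_latticePoint_eq_zero {n : ℕ} {h : ℝ} {u : (Fin n → ℝ) → ℝ}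
    {Ω : Set (Fin n → ℝ)} (hu : IsDiscreteHarmonicOn h u Ω) (z : Fin n → ℤ)
    (hz : latticePoint h z ∈ Ω)
    (hnb : ∀ i, latticePoint h (z + Pi.single i 1) ∈ Ω ∧ latticePoint h (z - Pi.single i 1) ∈ Ω) :
    latticeLaplacian (fun y => u (latticePoint h y)) z = 0 := by
  have h1 := hu _ (latticePoint_mem_discretize hz) fun i => by
    rw [← latticePoint_add_single, ← latticePoint_sub_single]
    exact ⟨latticePoint_mem_discretize (hnb i).1, latticePoint_mem_discretize (hnb i).2⟩
  simp only [IsDiscreteHarmonicAt, ← latticePoint_add_single, ← latticePoint_sub_single] at h1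
  simp only [latticeLaplacian, Finset.sum_sub_distrib, ← h1]
  simp; ring

lemma exists_int_abs_mul_sub_le_one {n : ℕ} (N : ℕ) (y : Fin n → ℝ) :
    ∃ z : Fin n → ℤ, ∀ i, |N * y i - z i| ≤ 1 :=
  ⟨fun i => round (N * y i), fun i => (abs_sub_round _).trans (by norm_num)⟩

/-- Rescaling the cube estimate, with `y` rounded to a lattice point `z₀`. Using `5/4` instead of
`3/2` absorbs the rounding: `5/4 ρN + 1 ≤ 3/2 (ρN - 2)` once `ρN ≥ 16`. -/
lemma PropagatesTo.closedBall_expand {n : ℕ} {Ω O : Set (Fin n → ℝ)}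
    {y : Fin n → ℝ} {ρ R : ℝ} (hρ : 0 < ρ) (hR : (16 * n + 2) * ρ ≤ R)
    (hball : Metric.closedBall y R ⊆ Ω) (hV : PropagatesTo Ω O (Metric.closedBall y ρ)) :
    PropagatesTo Ω O (Metric.closedBall y (5 / 4 * ρ)) := by
  obtain ⟨C₁, α₁, c₁, N₁, hC₁, hα₁, hα₁', hc₁, h₁⟩ := hV
  obtain ⟨C₂, α₂, c₂, hC₂, hα₂, hα₂', hc₂, h₂⟩ := exists_abs_le_of_small_on_cube n
  refine ⟨2 * C₁ * C₂, α₁ * α₂, min (c₁ * α₂) (c₂ * ρ / 2), max N₁ ⌈16 / ρ⌉₊, by nlinarith,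
    by positivity, by nlinarith, by positivity, ?_⟩
  intro N hN u hu hb x hx
  have hN₁ : N₁ < N := (le_max_left _ _).trans_lt hN
  have hN0 : 0 < N := by omega
  have hNpos : (0 : ℝ) < N := by exact_mod_cast hN0
  have hNρ : 16 ≤ ρ * N := by
    have h3 : 16 / ρ ≤ N := (Nat.le_ceil _).trans (by
      exact_mod_cast ((le_max_right _ _).trans_lt hN).le)
    rw [div_le_iff₀ hρ] at h3; linarith
  have hΩ := latticeMax_nonneg (N : ℝ)⁻¹ u Ω
  have ht := latticeMax_div_nonneg (N : ℝ)⁻¹ u O Ω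
  have h₁' := h₁ N hN₁ u hu hb
  generalize latticeMax (N : ℝ)⁻¹ u O / latticeMax (N : ℝ)⁻¹ u Ω = t at *
  have hMb : ∀ x ∈ discretize (N : ℝ)⁻¹ Ω, |u x| ≤ latticeMax (N : ℝ)⁻¹ u Ω :=
    fun x hx => abs_le_latticeMax hb hx
  generalize latticeMax (N : ℝ)⁻¹ u Ω = M at *
  obtain ⟨z₀, hz₀⟩ := exists_int_abs_mul_sub_le_one N y
  obtain ⟨m, hm1, hm2⟩ : ∃ m : ℕ, (m : ℝ) + 1 ≤ ρ * N ∧ ρ * N ≤ m + 2 := by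
    refine ⟨⌊ρ * N - 1⌋₊, ?_, ?_⟩
    · have := Nat.floor_le (show 0 ≤ ρ * N - 1 by linarith); linarith
    · have := Nat.lt_floor_add_one (ρ * N - 1); linarith
  set f : (Fin n → ℤ) → ℝ := fun z => u (latticePoint (N : ℝ)⁻¹ (z + z₀)) with hf
  have hmem : ∀ (z : Fin n → ℤ) (r : ℝ), 0 ≤ r → (∀ i, |(z i : ℝ)| + 1 ≤ r * N) →
      latticePoint (N : ℝ)⁻¹ (z + z₀) ∈ Metric.closedBall y r := by
    intro z r hr hz
    rw [Metric.mem_closedBall, dist_pi_le_iff hr]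
    intro i
    have h3 : latticePoint (N : ℝ)⁻¹ (z + z₀) i - y i =
        (N : ℝ)⁻¹ * (z i - (N * y i - z₀ i)) := by
      simp only [latticePoint, Pi.add_apply]; push_cast; field_simp; ring
    rw [Real.dist_eq, h3, abs_mul, abs_of_pos (inv_pos.2 hNpos), inv_mul_le_iff₀ hNpos]
    have h4 := abs_sub (z i : ℝ) (N * y i - z₀ i)
    linarith [hz i, hz₀ i]
  have hR0 : 0 ≤ R := le_trans (by positivity) hR
  have hmem' : ∀ z : Fin n → ℤ, (∀ i, |z i| ≤ (16 * n + 2) * m) →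
      latticePoint (N : ℝ)⁻¹ (z + z₀) ∈ Ω := by
    refine fun z hz => hball (hmem z R hR0 fun i => ?_)
    have h3 : |(z i : ℝ)| ≤ (16 * n + 2) * m := by exact_mod_cast hz i
    have h4 := mul_le_mul_of_nonneg_right hR hNpos.le
    have h5 := mul_le_mul_of_nonneg_left hm1 (show (0 : ℝ) ≤ 16 * n by positivity)
    have h6 : (0 : ℝ) ≤ n := by positivity
    linarith
  have hharm : ∀ z : Fin n → ℤ, (∀ i, |z i| < (16 * n + 2) * m) →
      latticeLaplacian f z = 0 := by
    intro z hz
    have hstep : ∀ i k, |(Pi.single i 1 : Fin n → ℤ) k| ≤ 1 := by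
      intro i k
      by_cases hk : k = i
      · subst hk; simp
      · simp [hk]
    rw [hf, latticeLaplacian_comp_add (fun z => u (latticePoint (N : ℝ)⁻¹ z))]
    refine latticeLaplacian_latticePoint_eq_zero hu _ (hmem' z fun i => (hz i).le)
      fun i => ⟨?_, ?_⟩
    · rw [add_right_comm]
      refine hmem' _ fun k => ?_
      have := abs_add_le (z k) ((Pi.single i 1 : Fin n → ℤ) k)
      rw [Pi.add_apply]; linarith [hstep i k, hz k]
    · rw [add_sub_right_comm]
      refine hmem' _ fun k => ?_
      have := abs_sub (z k) ((Pi.single i 1 : Fin n → ℤ) k)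
      rw [Pi.sub_apply]; linarith [hstep i k, hz k]
  have hfM : ∀ z : Fin n → ℤ, (∀ i, |z i| ≤ (16 * n + 2) * m) → |f z| ≤ M :=
    fun z hz => hMb _ (latticePoint_mem_discretize (hmem' z hz))
  set t' := C₁ * (t ^ α₁ + Real.exp (-c₁ * N)) with ht'
  have ht'0 : 0 ≤ t' := by have := Real.rpow_nonneg ht α₁; positivity
  have hsmall : ∀ z : Fin n → ℤ, (∀ i, |z i| ≤ m) → |f z| ≤ t' * M := by
    refine fun z hz => h₁' _ (latticePoint_mem_discretize (hmem z ρ hρ.le fun i => ?_))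
    have : |(z i : ℝ)| ≤ m := by exact_mod_cast hz i
    linarith
  choose k hk using hx.2
  have hxk : x = latticePoint (N : ℝ)⁻¹ k := funext hk
  have hxf : u x = f (k - z₀) := by simp only [hf, sub_add_cancel, hxk]
  have hkz : ∀ i, 2 * |(k - z₀) i| ≤ 3 * m := by
    intro i
    have h3 := (dist_pi_le_iff (by positivity)).1 (Metric.mem_closedBall.1 hx.1) i
    rw [Real.dist_eq] at h3
    have h4 : (k i : ℝ) - z₀ i = N * (x i - y i) + (N * y i - z₀ i) := by
      rw [hk i]; field_simp; ring
    have h5 := abs_add_le ((N : ℝ) * (x i - y i)) (N * y i - z₀ i)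
    rw [← h4, abs_mul, abs_of_pos hNpos] at h5
    have h6 := mul_le_mul_of_nonneg_left h3 hNpos.le
    have h7 : 2 * |(k i : ℝ) - z₀ i| ≤ 3 * m := by linarith [hz₀ i]
    rw [Pi.sub_apply]
    exact_mod_cast h7
  have hexp : Real.exp (-c₂ * m) ≤ Real.exp (-(c₂ * ρ / 2) * N) := by
    refine Real.exp_le_exp.2 ?_
    nlinarith
  have hcomp := rpow_add_exp_comp_le C₁ C₂ α₁ α₂ c₁ (c₂ * ρ / 2) t N hC₁ hC₂ hα₂ hα₂'.le ht
    hNpos.le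
  refine le_trans ?_ (mul_le_mul_of_nonneg_right hcomp hΩ)
  rw [hxf]
  refine (h₂ f M t' m ht'0 hharm hfM hsmall _ hkz).trans ?_
  gcongr

/-- Expansion is iterated as long as there is room. The final radius does not depend on `ρ`, which
is what makes the set of good points relatively closed. -/
lemma PropagatesTo.closedBall_expand_max {n : ℕ} {Ω O : Set (Fin n → ℝ)}
    {y : Fin n → ℝ} {ρ R : ℝ} (hρ : 0 < ρ)
    (hball : Metric.closedBall y R ⊆ Ω) (hV : PropagatesTo Ω O (Metric.closedBall y ρ)) :
    PropagatesTo Ω O (Metric.closedBall y (R / (16 * n + 2))) := by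
  have hκ : (0 : ℝ) < 16 * n + 2 := by positivity
  have step : ∀ k : ℕ,
      PropagatesTo Ω O (Metric.closedBall y (min ((5 / 4) ^ k * ρ) (R / (16 * n + 2)))) := by
    intro k
    induction k with
    | zero => exact hV.mono (Metric.closedBall_subset_closedBall (by simp))
    | succ k ih =>
      rcases le_total ((5 / 4) ^ k * ρ) (R / (16 * n + 2)) with h | h
      · rw [min_eq_left h] at ih
        have h1 := ih.closedBall_expand (by positivity)
          (by rw [le_div_iff₀ hκ] at h; linarith) hball
        exact h1.mono (Metric.closedBall_subset_closedBall
          ((min_le_left _ _).trans_eq (by ring)))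
      · rw [min_eq_right h] at ih
        exact ih.mono (Metric.closedBall_subset_closedBall (min_le_right _ _))
  obtain ⟨k, hk⟩ := pow_unbounded_of_one_lt (R / (16 * n + 2) / ρ)
    (show (1 : ℝ) < 5 / 4 by norm_num)
  rw [div_lt_iff₀ hρ] at hk
  simpa only [min_eq_right hk.le] using step k

/-! ### Connectedness and compactness. -/

/-- Smallness propagates to a neighbourhood of each point of the domain. -/
lemma exists_nhds_propagatesTo {n : ℕ} {Ω O : Set (Fin n → ℝ)} (hΩ : IsOpen Ω)
    (hconn : IsPreconnected Ω) (hO_open : IsOpen O) (hO_ne : O.Nonempty) (hO : O ⊆ Ω) :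
    ∀ x ∈ Ω, ∃ V ∈ nhds x, PropagatesTo Ω O V := by
  have hκ : (0 : ℝ) < 16 * n + 2 := by positivity
  have hopen : IsOpen {x : Fin n → ℝ | ∃ V ∈ nhds x, PropagatesTo Ω O V} := by
    rw [isOpen_iff_mem_nhds]
    rintro x ⟨V, hV, hVp⟩
    filter_upwards [eventually_mem_nhds_iff.2 hV] with y hy using ⟨V, hy, hVp⟩
  refine hconn.subset_of_closure_inter_subset hopen ?_ ?_
  · obtain ⟨x, hx⟩ := hO_ne
    exact ⟨x, hO hx, O, hO_open.mem_nhds hx, propagatesTo_self hO⟩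
  · rintro x ⟨hxc, hxΩ⟩
    obtain ⟨R, hR, hball⟩ := Metric.nhds_basis_closedBall.mem_iff.1 (hΩ.mem_nhds hxΩ)
    have hr : 0 < R / 2 / (16 * n + 2) := by positivity
    -- A good point `y` is taken so close to `x` that the ball of radius `R / 2` about `y` lies in
    -- `Ω` and the fully expanded ball about `y` still contains `x` in its interior.
    obtain ⟨y, ⟨V, hV, hVp⟩, hxy⟩ := Metric.mem_closure_iff.1 hxc _ hr
    obtain ⟨ρ, hρ, hρV⟩ := Metric.nhds_basis_closedBall.mem_iff.1 hV
    have hle : R / 2 / (16 * n + 2) ≤ R / 2 :=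
      div_le_self (by positivity) (by linarith [(by positivity : (0 : ℝ) ≤ n)])
    have h1 : Metric.closedBall y (R / 2) ⊆ Ω :=
      (Metric.closedBall_subset_closedBall' (by rw [dist_comm]; linarith)).trans hball
    have h2 := (hVp.mono hρV).closedBall_expand_max hρ h1
    exact ⟨_, Filter.mem_of_superset (Metric.isOpen_ball.mem_nhds hxy)
      Metric.ball_subset_closedBall, h2⟩

theorem mainTheorem4 (n : ℕ) (Ω O K : Set (Fin n → ℝ))
    (hΩ_open : IsOpen Ω) (hΩ_conn : IsConnected Ω)
    (hO_open : IsOpen O) (hO_ne : O.Nonempty) (hO : O ⊆ Ω)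
    (hK_compact : IsCompact K) (hK : K ⊆ Ω) :
    ∃ (C α δ : ℝ) (N₀ : ℕ), 0 < C ∧ 0 < α ∧ α < 1 ∧ 0 < δ ∧ δ < 1 ∧
      ∀ (N : ℕ), N₀ < N → ∀ (h : ℝ), h = (N : ℝ)⁻¹ →
        ∀ u : (Fin n → ℝ) → ℝ,
          IsDiscreteHarmonicOn h u Ω →
          BddAbove (absValues h u Ω) →
          latticeMax h u K ≤
            C * ((latticeMax h u O / latticeMax h u Ω) ^ α + δ ^ (Real.sqrt (N : ℝ))) *
              latticeMax h u Ω := by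
  have hloc := exists_nhds_propagatesTo hΩ_open hΩ_conn.isPreconnected hO_open hO_ne hO
  have hmain : PropagatesTo Ω O K := by
    refine hK_compact.induction_on (p := PropagatesTo Ω O)
      ((propagatesTo_self hO).mono (Set.empty_subset _)) (fun s t hst ht => ht.mono hst)
      (fun s t hs ht => hs.union hO ht) fun x hx => ?_
    obtain ⟨V, hV, hVp⟩ := hloc x (hK hx)
    exact ⟨V, mem_nhdsWithin_of_mem_nhds hV, hVp⟩
  obtain ⟨C, α, c, N₀, hC, hα, hα1, hc, hest⟩ := hmain
  refine ⟨C, α, Real.exp (-c), N₀, by linarith, hα, hα1, Real.exp_pos _,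
    Real.exp_lt_one_iff.2 (by linarith), ?_⟩
  rintro N hN h rfl u hu hb
  have hΩ := latticeMax_nonneg (N : ℝ)⁻¹ u Ω
  have ht := Real.rpow_nonneg (latticeMax_div_nonneg (N : ℝ)⁻¹ u O Ω) α
  -- Here `√N ≤ N` gives away the stronger exponential error.
  have hexp : Real.exp (-c * N) ≤ Real.exp (-c) ^ Real.sqrt (N : ℝ) := by
    rw [← Real.exp_mul]
    refine Real.exp_le_exp.2 ?_
    have h1 : (1 : ℝ) ≤ N := by exact_mod_cast (by omega : 1 ≤ N)
    have h2 : Real.sqrt (N : ℝ) ≤ N := Real.sqrt_le_iff.2 ⟨by linarith, by nlinarith⟩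
    nlinarith
  refine Real.sSup_le ?_ (by positivity)
  rintro _ ⟨x, hx, rfl⟩
  refine (hest N hN u hu hb x hx).trans ?_
  gcongr
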